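/- Let $\Phi:\mathbb{R}\to\mathbb{R}$ be a $C^2$, convex, symmetric (even) function satisfying the following hypothesis (H): there are $M>0$ and $0<\varepsilon\le 1/2$ with $\Phi(M)>0$ and $$(1+\varepsilon)\Phi(x)\le x\Phi'(x)\le(2-\varepsilon)\Phi(x)\qquad\text{for all }x\ge M.$$ Let $\mu_\Phi(dx)=Z_\Phi^{-1}e^{-\Phi(x)}\,dx$ with $Z_\Phi=\int_{\mathbb{R}} e^{-\Phi(x)}\,dx$ (which is finite), and let $\Phi^*(x)=\sup_{y\in\mathbb{R}}\{xy-\Phi(y)\}$. Then there are constants $A,B,D>0$ such that, with $$H_\Phi(x)=\begin{cases}\Phi^*(Bx)&\text{if }|x|>D,\\ x^2&\text{if }|x|\le D,\end{cases}$$ every locally absolutely continuous function $f>0$ on $\mathbb{R}$ with $\int f^2\,d\mu_\Phi<\infty$ satisfies $$\mathrm{Ent}_{\mu_\Phi}(f^2)\le A\int H_\Phi\!\left(\frac{f'}{f}\right)f^2\,d\mu_\Phi,$$ where $\mathrm{Ent}_{\mu}(f^2)=\int f^2\log f^2\,d\mu-\int f^2\,d\mu\,\log\int f^2\,d\mu$.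 Both sides are well defined in $(-\infty,+\infty]$, and the inequality is understood there: if the right-hand side is finite, then so is the left-hand side, and the inequality holds. -/

import Mathlib

open MeasureTheory Real Set

/-- Hypothesis (H), with the standing assumptions on the potential: `Φ` is a `C²`, convex, symmetric
function on the line and there are `M > 0` and `0 < ε ≤ 1/2` with `Φ M > 0` and
`(1 + ε) Φ x ≤ x Φ' x ≤ (2 - ε) Φ x` for all `x ≥ M`. -/
structure HypothesisH (Φ : ℝ → ℝ) : Prop where
  contDiff : ContDiff ℝ 2 Φ
  convex : ConvexOn ℝ univ Φ
  symm : ∀ x, Φ (-x) = Φ x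
  growth : ∃ M : ℝ, 0 < M ∧ ∃ ε : ℝ, 0 < ε ∧ ε ≤ 1 / 2 ∧ 0 < Φ M ∧
    ∀ x, M ≤ x → (1 + ε) * Φ x ≤ x * deriv Φ x ∧ x * deriv Φ x ≤ (2 - ε) * Φ x

/-- The measure `μ_Φ(dx) = exp (-Φ x) / Z_Φ dx`, with `Z_Φ = ∫ exp (-Φ x) dx`. -/
noncomputable def gibbsMeasure (Φ : ℝ → ℝ) : Measure ℝ :=
  volume.withDensity (fun x => ENNReal.ofReal (exp (-Φ x) / ∫ y, exp (-Φ y)))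

/-- The Legendre-Fenchel transform `Φ* x = sup_y (x y - Φ y)`; under (H) the supremum is finite, see
`HypothesisH.bddAbove` below. -/
noncomputable def legendre (Φ : ℝ → ℝ) (x : ℝ) : ℝ := ⨆ y : ℝ, (x * y - Φ y)

open Classical in
/-- The function `H_Φ` with parameters `B` and `D`: it is `Φ* (B x)` if `|x| > D` and `x²` if
`|x| ≤ D`. -/
noncomputable def modifiedH (Φ : ℝ → ℝ) (B D x : ℝ) : ℝ :=
  if D < |x| then legendre Φ (B * x) else x ^ 2

/-- Local absolute continuity on the line: absolute continuity on every compact interval. -/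
def LocallyAbsolutelyContinuous (f : ℝ → ℝ) : Prop :=
  ∀ a b : ℝ, AbsolutelyContinuousOnInterval f a b

/-- The entropy `Ent_μ(g) = ∫ g log g dμ - (∫ g dμ) log (∫ g dμ)`. -/
noncomputable def entropy (μ : Measure ℝ) (g : ℝ → ℝ) : ℝ :=
  ∫ x, g x * log (g x) ∂μ - (∫ x, g x ∂μ) * log (∫ x, g x ∂μ)

/-- Under (H), `Φ` grows faster than linearly. -/
theorem HypothesisH.superlinear {Φ : ℝ → ℝ} (h : HypothesisH Φ) (K : ℝ) :
    ∃ R : ℝ, ∀ y, R ≤ |y| → K * |y| ≤ Φ y := by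
  obtain ⟨M, hM, ε, hε, -, hΦM, hg⟩ := h.growth
  have hd : Differentiable ℝ Φ := h.contDiff.differentiable (by norm_num)
  have hder : ∀ x : ℝ, 0 < x → HasDerivAt (fun x => Φ x * x ^ (-(1 + ε)))
      (deriv Φ x * x ^ (-(1 + ε)) + Φ x * (-(1 + ε) * x ^ (-(1 + ε) - 1))) x := fun x hx =>
    (hd x).hasDerivAt.mul (Real.hasDerivAt_rpow_const (Or.inl hx.ne'))
  have hmono : MonotoneOn (fun x => Φ x * x ^ (-(1 + ε))) (Ici M) := by
    refine monotoneOn_of_deriv_nonneg (convex_Ici M)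
      (fun x hx => (hder x (hM.trans_le hx)).continuousAt.continuousWithinAt)
      (fun x hx => ?_) (fun x hx => ?_)
    · rw [interior_Ici] at hx
      exact (hder x (hM.trans hx)).differentiableAt.differentiableWithinAt
    · rw [interior_Ici] at hx
      have hx0 : 0 < x := hM.trans hx
      rw [(hder x hx0).deriv]
      have e : x ^ (-(1 + ε)) = x * x ^ (-(1 + ε) - 1) := by
        rw [Real.rpow_sub_one hx0.ne']; field_simp
      rw [e]
      have := mul_nonneg (sub_nonneg.2 (hg x hx.le).1) (Real.rpow_pos_of_pos hx0 (-(1 + ε) - 1)).le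
      linarith
  set c := Φ M * M ^ (-(1 + ε)) with hc
  have hcpos : 0 < c := mul_pos hΦM (Real.rpow_pos_of_pos hM _)
  have key : ∀ x, M ≤ x → c * x ^ ε * x ≤ Φ x := by
    intro x hx
    have hx0 : 0 < x := hM.trans_le hx
    have h1 : c ≤ Φ x * x ^ (-(1 + ε)) := hmono (mem_Ici.2 le_rfl) hx hx
    have h2 : (x ^ ε * x) * x ^ (-(1 + ε)) = 1 := by
      rw [← Real.rpow_add_one hx0.ne', ← Real.rpow_add hx0, show ε + 1 + -(1 + ε) = 0 by ring,
        Real.rpow_zero]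
    have h3 := mul_le_mul_of_nonneg_right h1
      (mul_pos (Real.rpow_pos_of_pos hx0 ε) hx0).le
    calc c * x ^ ε * x = c * (x ^ ε * x) := by ring
      _ ≤ Φ x * x ^ (-(1 + ε)) * (x ^ ε * x) := h3
      _ = Φ x * ((x ^ ε * x) * x ^ (-(1 + ε))) := by ring
      _ = Φ x := by rw [h2, mul_one]
  obtain ⟨R, hR⟩ := Filter.eventually_atTop.1
    ((tendsto_rpow_atTop hε).eventually_ge_atTop (K / c))
  refine ⟨max R M, fun y hy => ?_⟩
  have e : Φ y = Φ |y| := by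
    rcases abs_choice y with hy' | hy' <;> rw [hy']
    exact (h.symm y).symm
  rw [e]
  refine le_trans ?_ (key |y| ((le_max_right _ _).trans hy))
  have := hR |y| ((le_max_left _ _).trans hy)
  rw [div_le_iff₀ hcpos] at this
  exact mul_le_mul_of_nonneg_right (by linarith) (abs_nonneg y)

/-- Under (H), the supremum that defines `Φ* x` is finite. -/
theorem HypothesisH.bddAbove {Φ : ℝ → ℝ} (h : HypothesisH Φ) (x : ℝ) :
    BddAbove (range fun y : ℝ => x * y - Φ y) := by
  obtain ⟨R, hR⟩ := h.superlinear |x|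
  have hcont : Continuous fun y : ℝ => x * y - Φ y :=
    (continuous_const.mul continuous_id).sub h.contDiff.continuous
  obtain ⟨b, hb⟩ := (isCompact_Icc (a := -R) (b := R)).bddAbove_image hcont.continuousOn
  refine ⟨max b 0, ?_⟩
  rintro _ ⟨y, rfl⟩
  rcases le_total R |y| with hy | hy
  · refine le_max_of_le_right ?_
    have h1 := hR y hy
    have h2 := le_abs_self (x * y)
    rw [abs_mul] at h2
    show x * y - Φ y ≤ 0
    linarith
  · exact le_max_of_le_left (hb ⟨y, abs_le.1 hy, rfl⟩)

/-- Under (H), `Z_Φ` is finite. -/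
theorem HypothesisH.integrable {Φ : ℝ → ℝ} (h : HypothesisH Φ) :
    Integrable fun x => exp (-Φ x) := by
  obtain ⟨b, hb⟩ := h.bddAbove 1
  obtain ⟨b', hb'⟩ := h.bddAbove (-1)
  have h0 : Integrable fun x : ℝ => exp (-|x|) := by
    rw [← integrableOn_univ, ← Iic_union_Ioi (a := (0 : ℝ))]
    refine IntegrableOn.union
      ((integrableOn_exp_Iic 0).congr_fun (fun x hx => ?_) measurableSet_Iic)
      ((integrableOn_exp_neg_Ioi 0).congr_fun (fun x hx => ?_) measurableSet_Ioi)
    · simp [abs_of_nonpos (mem_Iic.1 hx)]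
    · simp [abs_of_pos (mem_Ioi.1 hx)]
  have hi : Integrable fun x : ℝ => exp (max b b') * exp (-|x|) := h0.const_mul _
  refine hi.mono' (by have := h.contDiff.continuous; fun_prop)
    (Filter.Eventually.of_forall fun x => ?_)
  have h1 : 1 * x - Φ x ≤ b := hb ⟨x, rfl⟩
  have h2 : -1 * x - Φ x ≤ b' := hb' ⟨x, rfl⟩
  rw [norm_of_nonneg (exp_pos _).le, ← exp_add]
  refine exp_le_exp.2 ?_
  have := le_max_left b b'
  have := le_max_right b b'
  rcases abs_choice x with hx | hx <;> rw [hx] <;> linarith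

/-- Under (H), `μ_Φ` is a probability measure. -/
theorem HypothesisH.isProbabilityMeasure {Φ : ℝ → ℝ} (h : HypothesisH Φ) :
    IsProbabilityMeasure (gibbsMeasure Φ) :=
  isProbabilityMeasure_tilted h.integrable

/-! By homogeneity assume `∫ f² dμ_Φ = 1`, and write `p` for the density of `μ_Φ`. The entropy is
then the integral of `f² log f² - f² + 1 ≥ 0`. Where `f` is bounded this is at most a multiple of
`(f - 1)²`, which the Poincaré inequality `exists_poincare` handles, since `y² ≤ H_Φ(y)`.

Where `f` is large, replace `f²` by a cut-off `u` and write `log u = log (u p) - log p`. As `log s ≤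
s`, a uniform bound `u p ≤ L` gives `u log u ≤ u (L + Φ + log Z)`. Since `∫ u p ≤ 1`, it remains to
bound `L` and the moment `∫ Φ u p` linearly by the right-hand side.

The moment comes from integrating `u'` against `x p` (`integral_mul_deriv_mul_le`): Young's
inequality splits `|x| |f'/f|` into a small multiple of `Φ`, absorbed on the left, and `H_Φ(f'/f)`.
The bound `L` comes from `u p ≤ ∫ |(u p)'|`, again controlled by that moment.

Differentiating the cut-off costs one power of it. The lower bound in (H) makes `Φ (s x)` contract
like `s ^ (1 + ε)`, and a high enough power of the cut-off recovers the loss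
(`exists_young_modifiedH`). The upper bound in (H) serves only to get `y² ≤ H_Φ(y)`. -/

namespace HypothesisH

variable {Φ : ℝ → ℝ}

/-! ### Convexity and growth of the potential. -/

theorem differentiable (h : HypothesisH Φ) : Differentiable ℝ Φ :=
  h.contDiff.differentiable (by norm_num)

theorem continuous_deriv (h : HypothesisH Φ) : Continuous (deriv Φ) :=
  h.contDiff.continuous_deriv (by norm_num)

theorem apply_abs (h : HypothesisH Φ) (x : ℝ) : Φ |x| = Φ x := by
  rcases abs_choice x with hx | hx <;> rw [hx]
  exact h.symm x

theorem apply_zero_le (h : HypothesisH Φ) (x : ℝ) : Φ 0 ≤ Φ x := by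
  have := h.convex.2 (mem_univ x) (mem_univ (-x)) (show (0 : ℝ) ≤ 1 / 2 by norm_num)
    (show (0 : ℝ) ≤ 1 / 2 by norm_num) (by norm_num)
  simp only [smul_eq_mul, h.symm] at this
  rw [show 1 / 2 * x + 1 / 2 * -x = 0 by ring] at this
  linarith

theorem le_of_abs_le (h : HypothesisH Φ) {x y : ℝ} (hxy : |x| ≤ |y|) : Φ x ≤ Φ y := by
  rw [← h.apply_abs x, ← h.apply_abs y]
  rcases (abs_nonneg x).eq_or_lt with h0 | h0
  · rw [← h0]; exact h.apply_zero_le _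
  have hy := h0.trans_le hxy
  have := h.convex.2 (mem_univ |y|) (mem_univ 0) (show 0 ≤ |x| / |y| by positivity)
    (show 0 ≤ 1 - |x| / |y| from sub_nonneg.2 (div_le_one_of_le₀ hxy hy.le)) (by ring)
  simp only [smul_eq_mul, mul_zero, add_zero] at this
  rw [div_mul_cancel₀ _ hy.ne'] at this
  have h1 : (1 - |x| / |y|) * Φ 0 ≤ (1 - |x| / |y|) * Φ |y| :=
    mul_le_mul_of_nonneg_left (h.apply_zero_le _)
      (by rw [sub_nonneg]; exact div_le_one_of_le₀ hxy hy.le)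
  linarith

/-- The tangent line of a convex function lies below it. -/
theorem add_deriv_mul_sub_le (h : HypothesisH Φ) (x y : ℝ) :
    Φ x + deriv Φ x * (y - x) ≤ Φ y := by
  rcases lt_trichotomy x y with hxy | rfl | hxy
  · have := h.convex.le_slope_of_hasDerivAt (mem_univ x) (mem_univ y) hxy
      (h.differentiable x).hasDerivAt
    rw [slope_def_field, le_div_iff₀ (by linarith)] at this
    linarith
  · simp
  · have := h.convex.slope_le_of_hasDerivAt (mem_univ y) (mem_univ x) hxy
      (h.differentiable x).hasDerivAt
    rw [slope_def_field, div_le_iff₀ (by linarith)] at this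
    linarith

theorem sub_le_mul_deriv (h : HypothesisH Φ) (x : ℝ) : Φ x - Φ 0 ≤ x * deriv Φ x := by
  have := h.add_deriv_mul_sub_le x 0
  linarith

theorem mul_deriv_nonneg (h : HypothesisH Φ) (x : ℝ) : 0 ≤ x * deriv Φ x :=
  (sub_nonneg.2 (h.apply_zero_le x)).trans (h.sub_le_mul_deriv x)

theorem abs_deriv_le (h : HypothesisH Φ) :
    ∃ C, 0 ≤ C ∧ ∀ x, |deriv Φ x| ≤ x * deriv Φ x + C := by
  obtain ⟨C, hC⟩ := (isCompact_Icc (a := (-1 : ℝ)) (b := 1)).exists_bound_of_continuousOn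
    h.continuous_deriv.continuousOn
  have hC0 : 0 ≤ C := (norm_nonneg _).trans (hC 0 (by simp))
  refine ⟨C, hC0, fun x => ?_⟩
  have h0 := h.mul_deriv_nonneg x
  rcases le_total |x| 1 with hx | hx
  · have := hC x (abs_le.1 hx)
    rw [norm_eq_abs] at this
    linarith
  · rw [← abs_of_nonneg h0, abs_mul]
    nlinarith [abs_nonneg (deriv Φ x)]

/-- The derivative is `x ^ (-c - 1) * (x Φ' x - c Φ x)`, so each half of (H) is a monotonicity
statement about `Φ` over a power. -/
theorem monotoneOn_mul_rpow {c M : ℝ} (h : HypothesisH Φ) (hM : 0 < M)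
    (hc : ∀ x, M ≤ x → c * Φ x ≤ x * deriv Φ x) :
    MonotoneOn (fun x => Φ x * x ^ (-c)) (Ici M) := by
  have hder : ∀ x : ℝ, 0 < x → HasDerivAt (fun x => Φ x * x ^ (-c))
      (deriv Φ x * x ^ (-c) + Φ x * (-c * x ^ (-c - 1))) x := fun x hx =>
    (h.differentiable x).hasDerivAt.mul (Real.hasDerivAt_rpow_const (Or.inl hx.ne'))
  refine monotoneOn_of_deriv_nonneg (convex_Ici M)
    (fun x hx => (hder x (hM.trans_le hx)).continuousAt.continuousWithinAt)
    (fun x hx => ?_) (fun x hx => ?_)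
  · rw [interior_Ici] at hx
    exact (hder x (hM.trans hx)).differentiableAt.differentiableWithinAt
  · rw [interior_Ici] at hx
    have hx0 : 0 < x := hM.trans hx
    rw [(hder x hx0).deriv]
    have e : x ^ (-c) = x * x ^ (-c - 1) := by
      rw [Real.rpow_sub_one hx0.ne']; field_simp
    rw [e]
    have := mul_nonneg (sub_nonneg.2 (hc x hx.le)) (Real.rpow_pos_of_pos hx0 (-c - 1)).le
    linarith

theorem antitoneOn_mul_rpow {c M : ℝ} (h : HypothesisH Φ) (hM : 0 < M)
    (hc : ∀ x, M ≤ x → x * deriv Φ x ≤ c * Φ x) :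
    AntitoneOn (fun x => Φ x * x ^ (-c)) (Ici M) := by
  have hder : ∀ x : ℝ, 0 < x → HasDerivAt (fun x => Φ x * x ^ (-c))
      (deriv Φ x * x ^ (-c) + Φ x * (-c * x ^ (-c - 1))) x := fun x hx =>
    (h.differentiable x).hasDerivAt.mul (Real.hasDerivAt_rpow_const (Or.inl hx.ne'))
  refine antitoneOn_of_deriv_nonpos (convex_Ici M)
    (fun x hx => (hder x (hM.trans_le hx)).continuousAt.continuousWithinAt)
    (fun x hx => ?_) (fun x hx => ?_)
  · rw [interior_Ici] at hx
    exact (hder x (hM.trans hx)).differentiableAt.differentiableWithinAt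
  · rw [interior_Ici] at hx
    have hx0 : 0 < x := hM.trans hx
    rw [(hder x hx0).deriv]
    have e : x ^ (-c) = x * x ^ (-c - 1) := by
      rw [Real.rpow_sub_one hx0.ne']; field_simp
    rw [e]
    have := mul_nonneg (sub_nonneg.2 (hc x hx.le)) (Real.rpow_pos_of_pos hx0 (-c - 1)).le
    linarith

/-- Under (H), `Φ` contracts faster than linearly. -/
theorem exists_apply_mul_le (h : HypothesisH Φ) : ∃ ε C : ℝ, 0 < ε ∧ 0 ≤ C ∧
    ∀ s x : ℝ, 0 ≤ s → s ≤ 1 → Φ (s * x) ≤ s ^ (1 + ε) * (Φ x - Φ 0) + C := by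
  obtain ⟨M, hM, ε, hε, -, hΦM, hg⟩ := h.growth
  -- `Φ M` covers `|s x| ≤ M`, where (H) says nothing; `|Φ 0|` pays for subtracting `Φ 0` on the
  -- right.
  refine ⟨ε, Φ M + |Φ 0|, hε, by positivity, fun s x hs hs1 => ?_⟩
  have hpow : 0 ≤ s ^ (1 + ε) := rpow_nonneg hs _
  have hpow1 : s ^ (1 + ε) ≤ 1 := rpow_le_one hs hs1 (by linarith)
  have hnn : 0 ≤ s ^ (1 + ε) * (Φ x - Φ 0) := mul_nonneg hpow (sub_nonneg.2 (h.apply_zero_le x))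
  have habs : |s * x| = s * |x| := by rw [abs_mul, abs_of_nonneg hs]
  rcases le_total |s * x| M with hx | hx
  · have : Φ (s * x) ≤ Φ M := h.le_of_abs_le (by rwa [abs_of_pos hM])
    have := abs_nonneg (Φ 0)
    linarith
  · have hsx : 0 < |s * x| := hM.trans_le hx
    have hx0 : 0 < |x| := by
      rw [habs] at hsx
      exact (pos_iff_pos_of_mul_pos hsx).1 (by
        rcases hs.eq_or_lt with h0 | h0
        · simp [← h0] at hsx
        · exact h0)
    have hle : |s * x| ≤ |x| := by rw [habs]; nlinarith
    have hs0 : 0 < s := by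
      rcases hs.eq_or_lt with h0 | h0
      · simp [← h0] at hsx
      · exact h0
    have key := h.monotoneOn_mul_rpow hM (fun x hx => (hg x hx).1) (mem_Ici.2 hx)
      (mem_Ici.2 (hx.trans hle)) hle
    simp only [h.apply_abs] at key
    rw [rpow_neg hsx.le, rpow_neg hx0.le, ← div_eq_mul_inv, ← div_eq_mul_inv,
      div_le_div_iff₀ (rpow_pos_of_pos hsx _) (rpow_pos_of_pos hx0 _), habs,
      mul_rpow hs hx0.le, ← mul_assoc] at key
    have key' := le_of_mul_le_mul_right key (rpow_pos_of_pos hx0 _)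
    have h1 : s ^ (1 + ε) * Φ 0 ≤ |Φ 0| := by
      calc s ^ (1 + ε) * Φ 0 ≤ s ^ (1 + ε) * |Φ 0| := by gcongr; exact le_abs_self _
        _ ≤ 1 * |Φ 0| := by gcongr
        _ = |Φ 0| := one_mul _
    linarith

/-- Under (H), `Φ` grows slower than any quadratic function. -/
theorem exists_le_mul_sq (h : HypothesisH Φ) {κ : ℝ} (hκ : 0 < κ) :
    ∃ R : ℝ, 0 < R ∧ ∀ x, R ≤ |x| → Φ x ≤ κ * x ^ 2 := by
  obtain ⟨M, hM, ε, hε, -, hΦM, hg⟩ := h.growth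
  set c := Φ M * M ^ (-(2 - ε)) with hc
  have hcpos : 0 < c := mul_pos hΦM (rpow_pos_of_pos hM _)
  obtain ⟨R, hR⟩ := Filter.eventually_atTop.1
    ((tendsto_rpow_atTop hε).eventually_ge_atTop (c / κ))
  refine ⟨max R M, lt_max_of_lt_right hM, fun x hx => ?_⟩
  have hMx := (le_max_right _ _).trans hx
  have hx0 : 0 < |x| := hM.trans_le hMx
  have key := h.antitoneOn_mul_rpow hM (fun x hx => (hg x hx).2) (mem_Ici.2 le_rfl)
    (mem_Ici.2 hMx) hMx
  simp only [h.apply_abs] at key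
  rw [← hc, rpow_neg hx0.le, ← div_eq_mul_inv, div_le_iff₀ (rpow_pos_of_pos hx0 _),
    rpow_sub hx0, rpow_two, sq_abs] at key
  have hp : 0 < |x| ^ ε := rpow_pos_of_pos hx0 _
  refine key.trans ?_
  have := hR |x| ((le_max_left _ _).trans hx)
  rw [div_le_iff₀ hκ] at this
  rw [← mul_div_assoc, div_le_iff₀ hp]
  nlinarith [sq_nonneg x]

/-- Beyond some `R` the slope of `Φ` is at least `1`, and before `R` it is nonnegative, so `Φ x ≥ Φ
t + (x - t) - R` for `0 ≤ t ≤ x`. This tail bound is the input of the Poincaré inequality. -/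
theorem exists_integral_Ioi_le (h : HypothesisH Φ) : ∃ K, 0 < K ∧
    ∀ t, 0 ≤ t → ∫ x in Ioi t, exp (-Φ x) ≤ K * exp (-Φ t) := by
  obtain ⟨R₀, hR₀⟩ := h.superlinear 2
  set R := max R₀ (|Φ 0| + 1) with hR
  have hR0 : 0 < R := lt_max_of_lt_right (by positivity)
  have hΦR : Φ 0 + R ≤ Φ R := by
    have h1 := hR₀ R (by rw [abs_of_pos hR0]; exact le_max_left _ _)
    rw [abs_of_pos hR0] at h1
    have h2 : |Φ 0| + 1 ≤ R := le_max_right _ _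
    have := le_abs_self (Φ 0)
    linarith
  have slope : ∀ t x, R ≤ t → t ≤ x → Φ t + (x - t) ≤ Φ x := by
    intro t x ht htx
    have h1 := h.add_deriv_mul_sub_le t x
    have h2 := h.add_deriv_mul_sub_le R 0
    have h3 := h.add_deriv_mul_sub_le R t
    have h4 := h.add_deriv_mul_sub_le t R
    -- The tangent at `R`, evaluated at `0`, gives `R Φ' R ≥ Φ R - Φ 0 ≥ R`.
    have hdR : 1 ≤ deriv Φ R := by
      by_contra! hlt
      nlinarith
    have hdt : deriv Φ R * (t - R) ≤ deriv Φ t * (t - R) := by linarith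
    rcases ht.eq_or_lt with rfl | ht'
    · nlinarith
    · have : deriv Φ R ≤ deriv Φ t := le_of_mul_le_mul_right hdt (by linarith)
      nlinarith
  have key : ∀ t x, 0 ≤ t → t ≤ x → Φ t + (x - t) - R ≤ Φ x := by
    intro t x ht htx
    rcases le_total R t with h1 | h1
    · linarith [slope t x h1 htx]
    · have hmono : ∀ y, t ≤ y → Φ t ≤ Φ y := fun y hy =>
        h.le_of_abs_le (by rwa [abs_of_nonneg ht, abs_of_nonneg (ht.trans hy)])
      rcases le_total R x with h2 | h2
      · linarith [slope R x le_rfl h2, hmono R h1]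
      · linarith [hmono x htx]
  refine ⟨exp R, exp_pos _, fun t ht => ?_⟩
  calc ∫ x in Ioi t, exp (-Φ x) ≤ ∫ x in Ioi t, exp (R + t - Φ t) * exp (-x) := by
        refine setIntegral_mono_on h.integrable.integrableOn
          ((integrableOn_exp_neg_Ioi t).const_mul _) measurableSet_Ioi fun x hx => ?_
        rw [← exp_add]
        exact exp_le_exp.2 (by linarith [key t x ht (mem_Ioi.1 hx).le])
    _ = exp R * exp (-Φ t) := by
        rw [integral_const_mul, integral_exp_neg_Ioi, ← exp_add, ← exp_add]
        ring_nf

/-! ### Young's inequality and the choice of `B` and `D`. -/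

/-- Young's inequality. -/
theorem abs_mul_abs_le (h : HypothesisH Φ) (a b : ℝ) : |a| * |b| ≤ Φ a + legendre Φ b := by
  have h1 : b * a - Φ a ≤ legendre Φ b := le_ciSup (h.bddAbove b) a
  have h2 : b * (-a) - Φ (-a) ≤ legendre Φ b := le_ciSup (h.bddAbove b) (-a)
  rw [h.symm] at h2
  rw [← abs_mul]
  rcases abs_choice (a * b) with h' | h' <;> rw [h'] <;> linarith

theorem legendre_le_of_abs_le (h : HypothesisH Φ) {a b : ℝ} (hab : |a| ≤ |b|) :
    legendre Φ a ≤ legendre Φ b := by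
  refine ciSup_le fun y => ?_
  have h1 := h.abs_mul_abs_le y b
  have h2 := le_abs_self (a * y)
  rw [abs_mul] at h2
  nlinarith [abs_nonneg y]

/-- The properties of `H_Φ` on which the modified logarithmic Sobolev inequality rests. -/
theorem exists_young_modifiedH (h : HypothesisH Φ) : ∃ (n : ℕ) (B D N : ℝ), 1 ≤ n ∧ 0 < B ∧ 0 < D ∧
    1 ≤ N ∧ (∀ y, y ^ 2 ≤ modifiedH Φ B D y) ∧ ∀ σ x y : ℝ, 0 ≤ σ → σ ≤ 1 →
      (3 * n + 5) * (σ ^ n * |x| * |y|) ≤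
        σ ^ (n + 1) * (Φ x - Φ 0) / 2 + N + modifiedH Φ B D y := by
  obtain ⟨ε, C, hε, hC, hscale⟩ := h.exists_apply_mul_le
  obtain ⟨m, hm⟩ := exists_nat_ge (1 / ε)
  -- With `n ε ≥ 1`, `(σ ^ n) ^ (1 + ε) ≤ σ ^ (n + 1)` for `σ ∈ [0, 1]`: the lost power of the
  -- cut-off is regained.
  set n := max m 1 with hn
  have hn1 : 1 ≤ n := le_max_right _ _
  have hnε : 1 ≤ n * ε := by
    rw [div_le_iff₀ hε] at hm
    refine hm.trans ?_
    gcongr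
    exact le_max_left _ _
  -- `3 n + 5` is the constant of `abs_deriv_cutoffSq_le`; the factor `2` compensates for applying
  -- Young to `σ ^ n / 2 * x`, which leaves `Φ` with the coefficient `1 / 2` needed for absorption.
  set B : ℝ := 2 * (3 * n + 5) with hB
  have hB0 : 0 < B := by positivity
  obtain ⟨R, hR0, hR⟩ := h.exists_le_mul_sq (κ := B ^ 2 / 4) (by positivity)
  set D : ℝ := B * R / 2 with hD
  have hD0 : 0 < D := by positivity
  refine ⟨n, B, D, C + |legendre Φ (B * D)| + 1, hn1, hB0, hD0, ?_, fun y => ?_, ?_⟩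
  · linarith [abs_nonneg (legendre Φ (B * D))]
  · unfold modifiedH
    split_ifs with hy
    -- The test point `2 y / B` gives `2 y² - y²`; `D = B R / 2` places it beyond `R`.
    · have h1 : B * y * (2 * y / B) - Φ (2 * y / B) ≤ legendre Φ (B * y) :=
        le_ciSup (h.bddAbove (B * y)) (2 * y / B)
      have h2 : Φ (2 * y / B) ≤ B ^ 2 / 4 * (2 * y / B) ^ 2 := by
        refine hR _ ?_
        rw [abs_div, abs_mul, abs_of_pos hB0, abs_two, le_div_iff₀ hB0]
        linarith
      have e1 : B * y * (2 * y / B) = 2 * y ^ 2 := by field_simp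
      have e2 : B ^ 2 / 4 * (2 * y / B) ^ 2 = y ^ 2 := by field_simp; ring
      linarith
    · exact le_rfl
  · intro σ x y hσ hσ1
    have hs : 0 ≤ σ ^ n / 2 := by positivity
    have hs1 : σ ^ n ≤ 1 := pow_le_one₀ hσ hσ1
    have h1 := h.abs_mul_abs_le (σ ^ n / 2 * x) (B * y)
    rw [abs_mul, abs_of_nonneg hs, abs_mul, abs_of_pos hB0] at h1
    have h2 := hscale (σ ^ n / 2) x hs (by linarith)
    have h3 : (σ ^ n / 2) ^ (1 + ε) ≤ σ ^ (n + 1) / 2 := by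
      rw [div_rpow (by positivity) (by norm_num), ← rpow_natCast, ← rpow_mul hσ, ← rpow_natCast]
      have : (2 : ℝ) ≤ 2 ^ (1 + ε) := by
        calc (2 : ℝ) = 2 ^ (1 : ℝ) := (rpow_one _).symm
          _ ≤ 2 ^ (1 + ε) := rpow_le_rpow_of_exponent_le (by norm_num) (by linarith)
      rcases hσ.eq_or_lt with h0 | h0
      · rw [← h0, zero_rpow (by positivity), zero_rpow (by positivity)]; simp
      · refine div_le_div₀ (by positivity) ?_ (by norm_num) this
        refine rpow_le_rpow_of_exponent_ge h0 hσ1 ?_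
        push_cast
        linarith
    have h4 := mul_le_mul_of_nonneg_right h3 (sub_nonneg.2 (h.apply_zero_le x))
    have h5 : legendre Φ (B * y) ≤ |legendre Φ (B * D)| + 1 + modifiedH Φ B D y := by
      unfold modifiedH
      split_ifs with hy
      · linarith [abs_nonneg (legendre Φ (B * D))]
      · have : legendre Φ (B * y) ≤ legendre Φ (B * D) := by
          refine h.legendre_le_of_abs_le ?_
          rw [abs_mul, abs_mul B D, abs_of_pos hD0]
          gcongr
          exact not_lt.1 hy
        linarith [le_abs_self (legendre Φ (B * D)), sq_nonneg y]
    have e : (3 * n + 5) * (σ ^ n * |x| * |y|) = σ ^ n / 2 * |x| * (B * |y|) := by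
      rw [hB]; ring
    rw [e]
    linarith

end HypothesisH

/-! ### Locally absolutely continuous functions and integrals over growing intervals. -/

theorem LipschitzWith.comp_absolutelyContinuousOnInterval {φ f : ℝ → ℝ} {a b : ℝ}
    (hφ : LipschitzWith 1 φ) (hf : AbsolutelyContinuousOnInterval f a b) :
    AbsolutelyContinuousOnInterval (fun x => φ (f x)) a b := by
  refine squeeze_zero (fun t => Finset.sum_nonneg fun i _ => dist_nonneg) (fun t => ?_) hf
  exact Finset.sum_le_sum fun i _ => by simpa using hφ.dist_le_mul (f (t.2 i).1) (f (t.2 i).2)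

theorem AbsolutelyContinuousOnInterval.fun_pow {f : ℝ → ℝ} {a b : ℝ}
    (hf : AbsolutelyContinuousOnInterval f a b) (n : ℕ) :
    AbsolutelyContinuousOnInterval (fun x => f x ^ n) a b := by
  induction n with
  | zero =>
    simp only [pow_zero]
    exact (LipschitzWith.const (1 : ℝ)).lipschitzOnWith.absolutelyContinuousOnInterval
  | succ n ih => simpa only [pow_succ] using ih.fun_mul hf

theorem ContDiff.locallyAbsolutelyContinuous {f : ℝ → ℝ} (hf : ContDiff ℝ 1 f) :
    LocallyAbsolutelyContinuous f :=
  fun _ _ => hf.contDiffOn.absolutelyContinuousOnInterval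

namespace LocallyAbsolutelyContinuous

variable {f g : ℝ → ℝ}

theorem mul (hf : LocallyAbsolutelyContinuous f) (hg : LocallyAbsolutelyContinuous g) :
    LocallyAbsolutelyContinuous fun x => f x * g x :=
  fun a b => (hf a b).fun_mul (hg a b)

theorem pow (hf : LocallyAbsolutelyContinuous f) (n : ℕ) :
    LocallyAbsolutelyContinuous fun x => f x ^ n :=
  fun a b => (hf a b).fun_pow n

theorem const_mul (hf : LocallyAbsolutelyContinuous f) (c : ℝ) :
    LocallyAbsolutelyContinuous fun x => c * f x :=
  fun a b => (hf a b).const_mul c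

theorem continuous (hf : LocallyAbsolutelyContinuous f) : Continuous f := by
  refine continuous_iff_continuousAt.2 fun x => ?_
  refine (hf (x - 1) (x + 1)).continuousOn.continuousAt ?_
  rw [uIcc_of_le (by linarith)]
  exact Icc_mem_nhds (by linarith) (by linarith)

theorem ae_differentiableAt (hf : LocallyAbsolutelyContinuous f) :
    ∀ᵐ x, DifferentiableAt ℝ f x := by
  have h : ∀ᵐ x : ℝ, ∀ n : ℕ, x ∈ uIcc (-(n : ℝ)) n → DifferentiableAt ℝ f x :=
    ae_all_iff.2 fun n => (hf (-n) n).ae_differentiableAt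
  filter_upwards [h] with x hx
  obtain ⟨n, hn⟩ := exists_nat_ge |x|
  refine hx n ?_
  rw [uIcc_of_le (by linarith [abs_nonneg x])]
  exact abs_le.1 hn

/-- A nonnegative integrable function is bounded by the integral of the absolute value of its
derivative. -/
theorem le_integral_abs_deriv (hf : LocallyAbsolutelyContinuous f)
    (hfi : Integrable f) (hd : Integrable (deriv f)) (x : ℝ) : f x ≤ ∫ y, |deriv f y| := by
  refine le_of_forall_pos_le_add fun η hη => ?_
  -- An integrable function on the line cannot stay above a positive constant, so the fundamental
  -- theorem of calculus can start where `f ≤ η`.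
  obtain ⟨y, hy⟩ : ∃ y, f y ≤ η := by
    by_contra! hcon
    have : Integrable (fun _ : ℝ => η) :=
      hfi.mono' aestronglyMeasurable_const (Filter.Eventually.of_forall fun y => by
        rw [norm_of_nonneg hη.le]; exact (hcon y).le)
    rw [integrable_const_iff] at this
    rcases this with h | h
    · exact hη.ne' h
    · have := h.measure_univ_lt_top
      simp at this
  have h1 := (hf y x).integral_deriv_eq_sub
  have h2 : ‖∫ t in y..x, deriv f t‖ ≤ ∫ t in uIoc y x, ‖deriv f t‖ :=
    intervalIntegral.norm_integral_le_integral_norm_uIoc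
  have h3 : ∫ t in uIoc y x, ‖deriv f t‖ ≤ ∫ t, ‖deriv f t‖ :=
    setIntegral_le_integral hd.norm (Filter.Eventually.of_forall fun _ => norm_nonneg _)
  rw [h1] at h2
  simp only [norm_eq_abs] at h2 h3
  have := le_abs_self (f x - f y)
  linarith

end LocallyAbsolutelyContinuous

theorem integral_le_of_intervalIntegral_le {g : ℝ → ℝ} {c : ℝ} (hg : Integrable g)
    (h : ∀ R : ℝ, 0 ≤ R → ∫ x in (-R)..R, g x ≤ c) : ∫ x, g x ≤ c :=
  le_of_tendsto (intervalIntegral_tendsto_integral hg Filter.tendsto_neg_atTop_atBot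
    Filter.tendsto_id) (by
      filter_upwards [Filter.eventually_ge_atTop 0] with R hR using by simpa only [id] using h R hR)

theorem integrable_and_integral_le_of_intervalIntegral_le {g : ℝ → ℝ} {c : ℝ} (hg : Continuous g)
    (hg0 : ∀ x, 0 ≤ g x) (h : ∀ R : ℝ, 0 ≤ R → ∫ x in (-R)..R, g x ≤ c) :
    Integrable g ∧ ∫ x, g x ≤ c := by
  have hi : Integrable g := by
    refine integrable_of_intervalIntegral_norm_bounded (a := fun R : ℝ => -R) (b := id)
      (l := Filter.atTop) c (fun R => ?_) Filter.tendsto_neg_atTop_atBot Filter.tendsto_id ?_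
    · exact (hg.integrableOn_Icc).mono_set Ioc_subset_Icc_self
    · filter_upwards [Filter.eventually_ge_atTop 0] with R hR
      simpa only [norm_eq_abs, abs_of_nonneg (hg0 _), id] using h R hR
  exact ⟨hi, integral_le_of_intervalIntegral_le hi h⟩

theorem intervalIntegral_le_integral_of_nonneg {g : ℝ → ℝ} (hg : Integrable g) (hg0 : ∀ x, 0 ≤ g x)
    {a b : ℝ} (hab : a ≤ b) : ∫ x in a..b, g x ≤ ∫ x, g x := by
  rw [intervalIntegral.integral_of_le hab]
  exact setIntegral_le_integral hg (Filter.Eventually.of_forall hg0)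

/-- A weighted Poincaré inequality on an interval, for a weight `p` with a primitive `-T` that it
dominates. -/
theorem AbsolutelyContinuousOnInterval.integral_sub_sq_mul_le {f p T : ℝ → ℝ} {a b c K : ℝ}
    (hf : AbsolutelyContinuousOnInterval f a b) (hab : a ≤ b) (hp : Continuous p)
    (hp0 : ∀ x, 0 ≤ p x)
    (hT : ∀ x, HasDerivAt T (-p x) x) (hTK : ∀ x ∈ Icc a b, |T x| ≤ K * p x)
    (hbd : (f a - c) ^ 2 * T a ≤ (f b - c) ^ 2 * T b)
    (hint : IntervalIntegrable (fun x => deriv f x ^ 2 * p x) volume a b) :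
    ∫ x in a..b, (f x - c) ^ 2 * p x ≤ 4 * K ^ 2 * ∫ x in a..b, deriv f x ^ 2 * p x := by
  have hdT : deriv T = fun x => -p x := funext fun x => (hT x).deriv
  have hTd : ContDiff ℝ 1 T := contDiff_one_iff_deriv.2
    ⟨fun x => (hT x).differentiableAt, by rw [hdT]; exact hp.neg⟩
  have hTac : AbsolutelyContinuousOnInterval T a b := hTd.locallyAbsolutelyContinuous a b
  have hcont : ContinuousOn f (uIcc a b) := hf.continuousOn
  have hfc : AbsolutelyContinuousOnInterval (fun x => f x - c) a b :=
    hf.fun_sub (LipschitzWith.const c).lipschitzOnWith.absolutelyContinuousOnInterval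
  have hg : AbsolutelyContinuousOnInterval (fun x => (f x - c) ^ 2) a b := hfc.fun_pow 2
  have key := hg.integral_deriv_mul_eq_sub hTac
  have hgp : IntervalIntegrable (fun x => (f x - c) ^ 2 * p x) volume a b :=
    ContinuousOn.intervalIntegrable (by fun_prop)
  have hgT : IntervalIntegrable (fun x => deriv (fun x => (f x - c) ^ 2) x * T x) volume a b :=
    hg.intervalIntegrable_deriv.mul_continuousOn hTac.continuousOn
  have e : ∫ x in a..b, (deriv (fun x => (f x - c) ^ 2) x * T x + (f x - c) ^ 2 * deriv T x) =
      (∫ x in a..b, deriv (fun x => (f x - c) ^ 2) x * T x) -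
        ∫ x in a..b, (f x - c) ^ 2 * p x := by
    rw [← intervalIntegral.integral_sub hgT hgp]
    refine intervalIntegral.integral_congr fun x _ => ?_
    simp only [hdT]
    ring
  -- Cauchy-Schwarz in the form `2 |f - c| |f'| K ≤ (f - c)² / 2 + 2 K² f'²`; the first term is
  -- absorbed after the integration by parts.
  have hle : ∫ x in a..b, deriv (fun x => (f x - c) ^ 2) x * T x ≤
      ∫ x in a..b, (1 / 2 * ((f x - c) ^ 2 * p x) + 2 * K ^ 2 * (deriv f x ^ 2 * p x)) := by
    refine intervalIntegral.integral_mono_ae_restrict hab hgT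
      ((hgp.const_mul _).add (hint.const_mul _)) ?_
    have had := hf.ae_differentiableAt
    rw [Filter.EventuallyLE, ae_restrict_iff' measurableSet_Icc]
    filter_upwards [had] with x hx hxI
    have hdx := hx (by rwa [uIcc_of_le hab])
    have hder : deriv (fun x => (f x - c) ^ 2) x = 2 * (f x - c) * deriv f x := by
      rw [((hdx.hasDerivAt.sub_const c).fun_pow 2).deriv]
      simp
    rw [hder]
    have h1 := hTK x hxI
    have hKp : 0 ≤ K * p x := (abs_nonneg _).trans h1
    have h2 : 2 * (f x - c) * deriv f x * T x ≤ 2 * (|f x - c| * |deriv f x|) * (K * p x) := by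
      calc 2 * (f x - c) * deriv f x * T x ≤ |2 * (f x - c) * deriv f x * T x| := le_abs_self _
        _ = 2 * (|f x - c| * |deriv f x|) * |T x| := by
          simp only [abs_mul, abs_two]; ring
        _ ≤ _ := by gcongr
    have h3 : 2 * |f x - c| * (K * |deriv f x|) ≤
        1 / 2 * |f x - c| ^ 2 + 2 * (K ^ 2 * |deriv f x| ^ 2) := by
      nlinarith [sq_nonneg (|f x - c| - 2 * (K * |deriv f x|))]
    rw [sq_abs, sq_abs] at h3
    nlinarith [mul_le_mul_of_nonneg_right h3 (hp0 x)]
  rw [intervalIntegral.integral_add (hgp.const_mul _) (hint.const_mul _),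
    intervalIntegral.integral_const_mul, intervalIntegral.integral_const_mul] at hle
  rw [e] at key
  linarith

/-! ### The Gibbs density, its Poincaré inequality and its moment bound. -/

/-- The density of `μ_Φ`. -/
noncomputable def gibbsDensity (Φ : ℝ → ℝ) (x : ℝ) : ℝ := exp (-Φ x) / ∫ y, exp (-Φ y)

theorem gibbsMeasure_eq (Φ : ℝ → ℝ) :
    gibbsMeasure Φ = volume.withDensity fun x => ENNReal.ofReal (gibbsDensity Φ x) := rfl

namespace HypothesisH

variable {Φ : ℝ → ℝ}

theorem partition_pos (h : HypothesisH Φ) : 0 < ∫ y, exp (-Φ y) :=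
  integral_exp_pos h.integrable

theorem gibbsDensity_pos (h : HypothesisH Φ) (x : ℝ) : 0 < gibbsDensity Φ x :=
  div_pos (exp_pos _) h.partition_pos

theorem log_gibbsDensity (h : HypothesisH Φ) (x : ℝ) :
    log (gibbsDensity Φ x) = -Φ x - log (∫ y, exp (-Φ y)) := by
  rw [gibbsDensity, log_div (exp_pos _).ne' h.partition_pos.ne', log_exp]

theorem gibbsDensity_neg (h : HypothesisH Φ) (x : ℝ) : gibbsDensity Φ (-x) = gibbsDensity Φ x := by
  rw [gibbsDensity, gibbsDensity, h.symm]

theorem hasDerivAt_gibbsDensity (h : HypothesisH Φ) (x : ℝ) :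
    HasDerivAt (gibbsDensity Φ) (-(deriv Φ x * gibbsDensity Φ x)) x := by
  have := ((h.differentiable x).hasDerivAt.neg.exp).div_const (∫ y, exp (-Φ y))
  convert! this using 1
  simp only [gibbsDensity, Pi.neg_apply]
  ring

theorem continuous_gibbsDensity (h : HypothesisH Φ) : Continuous (gibbsDensity Φ) :=
  continuous_iff_continuousAt.2 fun x => (h.hasDerivAt_gibbsDensity x).continuousAt

theorem deriv_gibbsDensity (h : HypothesisH Φ) :
    deriv (gibbsDensity Φ) = fun x => -(deriv Φ x * gibbsDensity Φ x) :=
  funext fun x => (h.hasDerivAt_gibbsDensity x).deriv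

theorem contDiff_gibbsDensity (h : HypothesisH Φ) : ContDiff ℝ 1 (gibbsDensity Φ) :=
  contDiff_one_iff_deriv.2 ⟨fun x => (h.hasDerivAt_gibbsDensity x).differentiableAt, by
    rw [h.deriv_gibbsDensity]
    exact (h.continuous_deriv.mul h.continuous_gibbsDensity).neg⟩

theorem integrable_gibbsDensity (h : HypothesisH Φ) : Integrable (gibbsDensity Φ) :=
  h.integrable.div_const _

theorem integral_gibbsDensity (h : HypothesisH Φ) : ∫ x, gibbsDensity Φ x = 1 := by
  simp only [gibbsDensity]
  rw [integral_div, div_self h.partition_pos.ne']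

theorem integrable_gibbsMeasure_iff (h : HypothesisH Φ) {g : ℝ → ℝ} :
    Integrable g (gibbsMeasure Φ) ↔ Integrable fun x => g x * gibbsDensity Φ x := by
  have hm : Measurable fun x => ENNReal.ofReal (gibbsDensity Φ x) :=
    h.continuous_gibbsDensity.measurable.ennreal_ofReal
  rw [gibbsMeasure_eq, integrable_withDensity_iff hm
    (Filter.Eventually.of_forall fun _ => ENNReal.ofReal_lt_top)]
  simp only [ENNReal.toReal_ofReal (h.gibbsDensity_pos _).le]

theorem integral_gibbsMeasure (h : HypothesisH Φ) (g : ℝ → ℝ) :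
    ∫ x, g x ∂(gibbsMeasure Φ) = ∫ x, g x * gibbsDensity Φ x := by
  have hm : Measurable fun x => ENNReal.ofReal (gibbsDensity Φ x) :=
    h.continuous_gibbsDensity.measurable.ennreal_ofReal
  rw [gibbsMeasure_eq, integral_withDensity_eq_integral_toReal_smul hm
    (Filter.Eventually.of_forall fun _ => ENNReal.ofReal_lt_top)]
  simp only [ENNReal.toReal_ofReal (h.gibbsDensity_pos _).le, smul_eq_mul, mul_comm]

/-- The Poincaré inequality for `μ_Φ`, centred at the value at the origin. -/
theorem exists_poincare (h : HypothesisH Φ) : ∃ K : ℝ, 0 < K ∧ ∀ f : ℝ → ℝ,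
    LocallyAbsolutelyContinuous f →
    Integrable (fun x => (f x - f 0) ^ 2 * gibbsDensity Φ x) →
    Integrable (fun x => deriv f x ^ 2 * gibbsDensity Φ x) →
    ∫ x, (f x - f 0) ^ 2 * gibbsDensity Φ x ≤ K * ∫ x, deriv f x ^ 2 * gibbsDensity Φ x := by
  obtain ⟨K, hK, htail⟩ := h.exists_integral_Ioi_le
  refine ⟨4 * K ^ 2, by positivity, fun f hf hfi hdi => ?_⟩
  set p := gibbsDensity Φ with hp
  have hpc : Continuous p := h.continuous_gibbsDensity
  have hp0 : ∀ x, 0 ≤ p x := fun x => (h.gibbsDensity_pos x).le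
  have hpi : Integrable p := h.integrable_gibbsDensity
  -- This is the tail `∫ y in Ioi x, p y`, written so that its derivative is immediate.
  set T : ℝ → ℝ := fun x => (∫ y in Ioi 0, p y) - ∫ y in (0 : ℝ)..x, p y with hTdef
  have hT : ∀ x, HasDerivAt T (-p x) x := fun x =>
    (hpc.integral_hasStrictDerivAt 0 x).hasDerivAt.const_sub _
  have hTioi : ∀ x, T x = ∫ y in Ioi x, p y := fun x => by
    rw [hTdef]
    simp only
    rw [← intervalIntegral.integral_Ioi_sub_Ioi' hpi.integrableOn hpi.integrableOn]
    ring
  have hT0 : ∀ x, 0 ≤ T x := fun x => by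
    rw [hTioi]; exact integral_nonneg hp0
  have hTK : ∀ x, 0 ≤ x → |T x| ≤ K * p x := fun x hx => by
    rw [abs_of_nonneg (hT0 x), hTioi]
    simp only [hp, gibbsDensity]
    rw [integral_div, ← mul_div_assoc]
    exact div_le_div_of_nonneg_right (htail x hx) h.partition_pos.le
  refine integral_le_of_intervalIntegral_le hfi fun R hR => ?_
  have hpos := (hf 0 R).integral_sub_sq_mul_le (c := f 0) hR hpc hp0 hT
    (fun x hx => hTK x hx.1) (by
      simp only [sub_self, ne_eq, OfNat.ofNat_ne_zero, not_false_eq_true, zero_pow, zero_mul]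
      exact mul_nonneg (sq_nonneg _) (hT0 R)) hdi.intervalIntegrable
  -- On the negative half-line the primitive is the reflected tail. In both halves the boundary term
  -- at `0` vanishes because `c = f 0`, and the other has a favourable sign.
  have hneg := (hf (-R) 0).integral_sub_sq_mul_le (c := f 0) (K := K) (T := fun x => -T (-x))
    (by linarith) hpc hp0 (fun x => by
      have := ((hT (-x)).comp x (hasDerivAt_neg x)).neg
      convert! this using 1
      simp only [hp, h.gibbsDensity_neg]
      ring)
    (fun x hx => by
      have := hTK (-x) (by linarith [hx.2])
      rw [abs_neg]
      simpa only [hp, h.gibbsDensity_neg] using this) (by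
      have := mul_nonneg (sq_nonneg (f (-R) - f 0)) (hT0 R)
      simp only [sub_self, ne_eq, OfNat.ofNat_ne_zero, not_false_eq_true, zero_pow, zero_mul,
        neg_neg]
      linarith) hdi.intervalIntegrable
  have e1 := intervalIntegral.integral_add_adjacent_intervals
    (hfi.intervalIntegrable (a := -R) (b := 0)) (hfi.intervalIntegrable (a := 0) (b := R))
  have e2 := intervalIntegral.integral_add_adjacent_intervals
    (hdi.intervalIntegrable (a := -R) (b := 0)) (hdi.intervalIntegrable (a := 0) (b := R))
  have e3 : ∫ x in (-R)..R, deriv f x ^ 2 * p x ≤ ∫ x, deriv f x ^ 2 * p x :=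
    intervalIntegral_le_integral_of_nonneg hdi (fun x => mul_nonneg (sq_nonneg _) (hp0 x))
      (by linarith)
  have e4 := mul_le_mul_of_nonneg_left e3 (show 0 ≤ 4 * K ^ 2 by positivity)
  rw [← e2] at e4
  rw [← e1]
  linarith

/-- Control of the moment `∫ x Φ' u dμ_Φ` by integration by parts against the field `x ↦ x`. -/
theorem integral_mul_deriv_mul_le (h : HypothesisH Φ) {u q : ℝ → ℝ}
    (hu : LocallyAbsolutelyContinuous u) (hu0 : ∀ x, 0 ≤ u x) (hq0 : ∀ x, 0 ≤ q x)
    (hui : Integrable fun x => u x * gibbsDensity Φ x)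
    (hqi : Integrable fun x => q x * gibbsDensity Φ x)
    (hle : ∀ᵐ x, x * deriv u x ≤ u x * (Φ x - Φ 0) / 2 + q x) :
    Integrable (fun x => x * deriv Φ x * u x * gibbsDensity Φ x) ∧
      ∫ x, x * deriv Φ x * u x * gibbsDensity Φ x ≤
        2 * ((∫ x, u x * gibbsDensity Φ x) + ∫ x, q x * gibbsDensity Φ x) := by
  set p := gibbsDensity Φ with hp
  have hpc : Continuous p := h.continuous_gibbsDensity
  have hp0 : ∀ x, 0 ≤ p x := fun x => (h.gibbsDensity_pos x).le
  have huc := hu.continuous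
  have hΦ'c := h.continuous_deriv
  have hwc : Continuous fun x => x * deriv Φ x * u x * p x := by fun_prop
  -- Half of the moment is absorbed on the left, which is legitimate only where it is known to be
  -- finite; hence the work on `[-R, R]`, with a bound independent of `R`.
  refine integrable_and_integral_le_of_intervalIntegral_le hwc
    (fun x => mul_nonneg (mul_nonneg (h.mul_deriv_nonneg x) (hu0 x)) (hp0 x)) fun R hR => ?_
  have hxp : ContDiff ℝ 1 fun x => x * p x := contDiff_id.mul h.contDiff_gibbsDensity
  have hdxp : deriv (fun x => x * p x) = fun x => p x - x * deriv Φ x * p x := funext fun x => by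
    have := ((hasDerivAt_id x).mul (h.hasDerivAt_gibbsDensity x)).deriv
    simp only [id] at this
    refine this.trans ?_
    ring
  have hRR : -R ≤ R := by linarith
  have hxpac := hxp.locallyAbsolutelyContinuous (-R) R
  have key := (hu (-R) R).integral_deriv_mul_eq_sub hxpac
  have hw := hwc.intervalIntegrable (μ := volume) (-R) R
  have hu' : IntervalIntegrable (fun x => deriv u x * (x * p x)) volume (-R) R :=
    (hu (-R) R).intervalIntegrable_deriv.mul_continuousOn hxpac.continuousOn
  have hup : IntervalIntegrable (fun x => u x * p x) volume (-R) R := hui.intervalIntegrable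
  have hqp : IntervalIntegrable (fun x => q x * p x) volume (-R) R := hqi.intervalIntegrable
  have e : ∫ x in (-R)..R, (deriv u x * (x * p x) + u x * deriv (fun x => x * p x) x) =
      (∫ x in (-R)..R, deriv u x * (x * p x)) + (∫ x in (-R)..R, u x * p x) -
        ∫ x in (-R)..R, x * deriv Φ x * u x * p x := by
    rw [← intervalIntegral.integral_add hu' hup, ← intervalIntegral.integral_sub (hu'.add hup) hw]
    refine intervalIntegral.integral_congr fun x _ => ?_
    simp only [hdxp]
    ring
  have hbd : 0 ≤ u R * (R * p R) - u (-R) * (-R * p (-R)) := by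
    have h1 := mul_nonneg (hu0 R) (mul_nonneg hR (hp0 R))
    have h2 := mul_nonneg (hu0 (-R)) (mul_nonneg hR (hp0 (-R)))
    linarith
  have hmono : ∫ x in (-R)..R, deriv u x * (x * p x) ≤
      ∫ x in (-R)..R, (1 / 2 * (x * deriv Φ x * u x * p x) + q x * p x) := by
    refine intervalIntegral.integral_mono_ae hRR hu' ((hw.const_mul _).add hqp) ?_
    filter_upwards [hle] with x hx
    have h1 := mul_le_mul_of_nonneg_right hx (hp0 x)
    have h2 := mul_le_mul_of_nonneg_left (h.sub_le_mul_deriv x) (mul_nonneg (hu0 x) (hp0 x))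
    linarith
  rw [intervalIntegral.integral_add (hw.const_mul _) hqp,
    intervalIntegral.integral_const_mul] at hmono
  have h1 := intervalIntegral_le_integral_of_nonneg hui
    (fun x => mul_nonneg (hu0 x) (hp0 x)) hRR
  have h2 := intervalIntegral_le_integral_of_nonneg hqi
    (fun x => mul_nonneg (hq0 x) (hp0 x)) hRR
  rw [e] at key
  linarith

end HypothesisH

/-! ### The cut-off of `f²`. -/

/-- The cut-off that is `0` up to `2`, `1` from `3` on, and affine in between. -/
noncomputable def unitClamp (t : ℝ) : ℝ := max 0 (min 1 (t - 2))

theorem unitClamp_nonneg (t : ℝ) : 0 ≤ unitClamp t := le_max_left _ _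

theorem unitClamp_le_one (t : ℝ) : unitClamp t ≤ 1 := max_le zero_le_one (min_le_left _ _)

theorem unitClamp_of_le {t : ℝ} (ht : t ≤ 2) : unitClamp t = 0 :=
  max_eq_left ((min_le_right _ _).trans (by linarith))

theorem unitClamp_of_ge {t : ℝ} (ht : 3 ≤ t) : unitClamp t = 1 := by
  rw [unitClamp, min_eq_left (by linarith), max_eq_right zero_le_one]

theorem lipschitzWith_unitClamp : LipschitzWith 1 unitClamp := by
  refine LipschitzWith.of_dist_le_mul fun x y => ?_
  simp only [NNReal.coe_one, one_mul, dist_eq, unitClamp]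
  refine (abs_max_sub_max_le_max 0 _ 0 _).trans (max_le (by simp) ?_)
  refine (abs_min_sub_min_le_max 1 _ 1 _).trans (max_le (by simp) ?_)
  simp

theorem abs_deriv_comp_le {φ f : ℝ → ℝ} {x : ℝ} (hφ : LipschitzWith 1 φ)
    (hf : DifferentiableAt ℝ f x) (hg : DifferentiableAt ℝ (fun y => φ (f y)) x) :
    |deriv (fun y => φ (f y)) x| ≤ |deriv f x| := by
  refine le_of_tendsto_of_tendsto hg.hasDerivAt.tendsto_slope.abs hf.hasDerivAt.tendsto_slope.abs
    (Filter.Eventually.of_forall fun y => ?_)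
  simp only [slope_def_field, abs_div]
  have := hφ.dist_le_mul (f y) (f x)
  simp only [NNReal.coe_one, one_mul, dist_eq] at this
  gcongr

/-- The clamp is constant above `3`, so its derivative matters only where `f ≤ 3`, and there `|f'| ≤
3 |f'/f|`. -/
theorem abs_deriv_unitClamp_comp_le {f : ℝ → ℝ} {x : ℝ} (hfx : 0 < f x)
    (hf : DifferentiableAt ℝ f x) (hg : DifferentiableAt ℝ (fun y => unitClamp (f y)) x) :
    |deriv (fun y => unitClamp (f y)) x| ≤ 3 * |deriv f x / f x| := by
  rcases le_or_gt (f x) 3 with h3 | h3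
  · refine (abs_deriv_comp_le lipschitzWith_unitClamp hf hg).trans ?_
    rw [abs_div, abs_of_pos hfx, ← mul_div_assoc, le_div_iff₀ hfx]
    nlinarith [abs_nonneg (deriv f x)]
  · have : (fun y => unitClamp (f y)) =ᶠ[nhds x] fun _ => 1 := by
      filter_upwards [hf.continuousAt.eventually (lt_mem_nhds h3)] with y hy
      exact unitClamp_of_ge hy.le
    rw [this.deriv_eq]
    simp

/-- The square of `f`, cut off smoothly below the level `3`. -/
noncomputable def cutoffSq (n : ℕ) (f : ℝ → ℝ) (x : ℝ) : ℝ := f x ^ 2 * unitClamp (f x) ^ (n + 1)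

section cutoffSq

variable {n : ℕ} {f : ℝ → ℝ} {x : ℝ}

theorem cutoffSq_nonneg (n : ℕ) (f : ℝ → ℝ) (x : ℝ) : 0 ≤ cutoffSq n f x :=
  mul_nonneg (sq_nonneg _) (pow_nonneg (unitClamp_nonneg _) _)

theorem cutoffSq_le_sq (n : ℕ) (f : ℝ → ℝ) (x : ℝ) : cutoffSq n f x ≤ f x ^ 2 :=
  mul_le_of_le_one_right (sq_nonneg _) (pow_le_one₀ (unitClamp_nonneg _) (unitClamp_le_one _))

theorem cutoffSq_of_le (h : f x ≤ 2) : cutoffSq n f x = 0 := by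
  rw [cutoffSq, unitClamp_of_le h, zero_pow (by omega), mul_zero]

theorem cutoffSq_of_ge (h : 3 ≤ f x) : cutoffSq n f x = f x ^ 2 := by
  rw [cutoffSq, unitClamp_of_ge h, one_pow, mul_one]

theorem cutoffSq_le (n : ℕ) (f : ℝ → ℝ) (x : ℝ) : cutoffSq n f x ≤ 4 * (f x - 1) ^ 2 := by
  rcases le_total (f x) 2 with h | h
  · rw [cutoffSq_of_le h]; positivity
  · refine (cutoffSq_le_sq n f x).trans ?_
    nlinarith

theorem LocallyAbsolutelyContinuous.cutoffSq (hf : LocallyAbsolutelyContinuous f) (n : ℕ) :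
    LocallyAbsolutelyContinuous (cutoffSq n f) :=
  (hf.pow 2).mul (LocallyAbsolutelyContinuous.pow
    (fun a b => lipschitzWith_unitClamp.comp_absolutelyContinuousOnInterval (hf a b)) (n + 1))

/-- The derivative of `f²` contributes `2` and that of the clamp `3 (n + 1)`; only `n` of the `n +
1` powers survive. -/
theorem abs_deriv_cutoffSq_le (hfx : 0 < f x) (hf : DifferentiableAt ℝ f x)
    (hg : DifferentiableAt ℝ (fun y => unitClamp (f y)) x) :
    |deriv (cutoffSq n f) x| ≤
      (3 * n + 5) * (f x ^ 2 * unitClamp (f x) ^ n * |deriv f x / f x|) := by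
  have hder := ((hf.hasDerivAt.fun_pow 2).fun_mul (hg.hasDerivAt.fun_pow (n + 1))).deriv
  have h1 := abs_deriv_unitClamp_comp_le hfx hf hg
  set g' := deriv (fun y => unitClamp (f y)) x
  set σ := unitClamp (f x) with hσ
  have hσ0 : 0 ≤ σ := unitClamp_nonneg _
  have hσ1 : σ ≤ 1 := unitClamp_le_one _
  have e : deriv (_root_.cutoffSq n f) x =
      σ ^ n * f x ^ 2 * (2 * σ * (deriv f x / f x) + (n + 1) * g') := by
    refine hder.trans ?_
    simp only [Nat.add_sub_cancel]
    push_cast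
    field_simp
    ring
  rw [e, abs_mul, abs_of_nonneg (by positivity)]
  have h2 : |2 * σ * (deriv f x / f x) + (n + 1) * g'| ≤ (3 * n + 5) * |deriv f x / f x| := by
    refine (abs_add_le _ _).trans ?_
    rw [abs_mul, abs_mul, abs_mul, abs_two, abs_of_nonneg hσ0,
      abs_of_nonneg (by positivity : (0 : ℝ) ≤ n + 1)]
    have h3 : 2 * σ * |deriv f x / f x| ≤ 2 * 1 * |deriv f x / f x| := by gcongr
    have h4 : ((n : ℝ) + 1) * |g'| ≤ (n + 1) * (3 * |deriv f x / f x|) := by gcongr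
    linarith
  calc σ ^ n * f x ^ 2 * |2 * σ * (deriv f x / f x) + (n + 1) * g'|
      ≤ σ ^ n * f x ^ 2 * ((3 * n + 5) * |deriv f x / f x|) := by gcongr
    _ = _ := by ring

end cutoffSq

/-! ### Pointwise entropy bound and recentring. -/

/-- The integrand of the entropy, away from the mean, is controlled by its quadratic part and the
part where `f` is large. -/
theorem sq_mul_log_sq_le {t w u L : ℝ} (ht : 0 < t) (hu2 : t ≤ 2 → u = 0) (hu0 : 0 ≤ u)
    (hu3 : 3 ≤ t → u = t ^ 2) (hw : 0 < w) (hL : u * w ≤ L) :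
    t ^ 2 * log (t ^ 2) - t ^ 2 + 1 ≤ 17 * (t - 1) ^ 2 + u * (L - log w) := by
  have hlog : u * log u ≤ u * (L - log w) := by
    rcases hu0.eq_or_lt with h0 | h0
    · simp [← h0]
    · have huw : 0 < u * w := mul_pos h0 hw
      -- The crude `log s ≤ s` keeps the bound linear in `L`.
      have h1 : log (u * w) ≤ L := (log_le_self huw.le).trans hL
      rw [log_mul h0.ne' hw.ne'] at h1
      exact mul_le_mul_of_nonneg_left (by linarith) hu0
  rcases le_total 3 t with h3 | h3
  · rw [hu3 h3] at hlog ⊢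
    nlinarith
  · have h1 : log (t ^ 2) ≤ t ^ 2 - 1 := log_le_sub_one_of_pos (by positivity)
    have h2 : t ^ 2 * log (t ^ 2) ≤ t ^ 2 * (t ^ 2 - 1) :=
      mul_le_mul_of_nonneg_left h1 (sq_nonneg t)
    have h3' : t ^ 2 * log (t ^ 2) - t ^ 2 + 1 ≤ 16 * (t - 1) ^ 2 := by
      have : (t + 1) ^ 2 ≤ 16 := by nlinarith
      nlinarith [mul_le_mul_of_nonneg_right this (sq_nonneg (t - 1))]
    have h4 : -(t - 1) ^ 2 ≤ u * log u := by
      rcases le_total t 2 with h2 | h2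
      · rw [hu2 h2]; nlinarith [sq_nonneg (t - 1)]
      · rcases hu0.eq_or_lt with h0 | h0
        · rw [← h0]; nlinarith [sq_nonneg (t - 1)]
        · have := one_sub_inv_le_log_of_pos h0
          have h5 := mul_le_mul_of_nonneg_left this hu0
          rw [mul_sub, mul_inv_cancel₀ h0.ne'] at h5
          nlinarith
    linarith

theorem sq_mul_log_sq_nonneg {t : ℝ} (ht : 0 < t) : 0 ≤ t ^ 2 * log (t ^ 2) - t ^ 2 + 1 := by
  have h0 : 0 < t ^ 2 := by positivity
  have h5 := mul_le_mul_of_nonneg_left (one_sub_inv_le_log_of_pos h0) h0.le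
  rw [mul_sub, mul_inv_cancel₀ h0.ne'] at h5
  linarith

/-- If `∫ f² p = 1` and `f 0 > 0`, then `f` is close to `1` in mean square as soon as it is close
to `f 0`. -/
theorem integral_sub_one_sq_mul_le {f p : ℝ → ℝ} (hfm : Continuous f) (hp : Continuous p)
    (hp0 : ∀ x, 0 ≤ p x) (hpi : Integrable p) (hp1 : ∫ x, p x = 1) (hf0 : 0 < f 0)
    (hfi : Integrable fun x => f x ^ 2 * p x) (hf1 : ∫ x, f x ^ 2 * p x = 1) :
    (∀ c, Integrable fun x => (f x - c) ^ 2 * p x) ∧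
      ∫ x, (f x - 1) ^ 2 * p x ≤ 4 * ∫ x, (f x - f 0) ^ 2 * p x := by
  have hfp : Integrable fun x => f x * p x := by
    refine (hfi.add hpi).mono' (by fun_prop) (Filter.Eventually.of_forall fun x => ?_)
    rw [norm_mul, norm_eq_abs, norm_of_nonneg (hp0 x), Pi.add_apply]
    nlinarith [mul_nonneg (sq_nonneg (|f x| - 1)) (hp0 x), sq_abs (f x),
      mul_nonneg (sq_nonneg (f x)) (hp0 x), hp0 x]
  have hexp : ∀ c, (fun x => (f x - c) ^ 2 * p x) =
      fun x => f x ^ 2 * p x - 2 * c * (f x * p x) + c ^ 2 * p x := fun c => by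
    ext x; ring
  have hint : ∀ c, Integrable fun x => (f x - c) ^ 2 * p x := fun c => by
    rw [hexp]
    exact (hfi.sub (hfp.const_mul _)).add (hpi.const_mul _)
  have hval : ∀ c, ∫ x, (f x - c) ^ 2 * p x = 1 - 2 * c * (∫ x, f x * p x) + c ^ 2 := fun c => by
    rw [hexp]
    refine (integral_add (hfi.sub (hfp.const_mul _)) (hpi.const_mul _)).trans ?_
    rw [integral_const_mul, hp1, mul_one]
    congr 1
    refine (integral_sub hfi (hfp.const_mul _)).trans ?_
    rw [integral_const_mul, hf1]
  refine ⟨hint, ?_⟩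
  have hnn : ∀ c, 0 ≤ ∫ x, (f x - c) ^ 2 * p x := fun c =>
    integral_nonneg fun x => mul_nonneg (sq_nonneg _) (hp0 x)
  have h1 := hnn 1
  have h2 := hnn (-1)
  rw [hval] at h1 h2
  rw [hval, hval]
  set a := ∫ x, f x * p x
  -- The difference of the two sides is affine in the mean `a ∈ [-1, 1]`, so nonnegativity at `a =
  -- ±1` suffices; `f 0 > 0` is needed at `a = -1`.
  have h3 : 0 ≤ (1 - a) * (2 * f 0 ^ 2 + 4 * f 0) := mul_nonneg (by linarith) (by positivity)
  have h4 : 0 ≤ (1 + a) * (2 * (f 0 - 1) ^ 2) := mul_nonneg (by linarith) (by positivity)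
  linarith

/-! ### The inequality for normalized `f`, then in general. -/

namespace HypothesisH

variable {Φ : ℝ → ℝ}

theorem exists_entropy_bound_of_normalized (h : HypothesisH Φ) :
    ∃ A B D : ℝ, 0 < A ∧ 0 < B ∧ 0 < D ∧ ∀ f : ℝ → ℝ, LocallyAbsolutelyContinuous f →
      (∀ x, 0 < f x) → Integrable (fun x => f x ^ 2 * gibbsDensity Φ x) →
      ∫ x, f x ^ 2 * gibbsDensity Φ x = 1 →
      Integrable (fun x => modifiedH Φ B D (deriv f x / f x) * f x ^ 2 * gibbsDensity Φ x) →
      Integrable (fun x => (f x ^ 2 * log (f x ^ 2) - f x ^ 2 + 1) * gibbsDensity Φ x) ∧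
      ∫ x, (f x ^ 2 * log (f x ^ 2) - f x ^ 2 + 1) * gibbsDensity Φ x ≤
        A * ∫ x, modifiedH Φ B D (deriv f x / f x) * f x ^ 2 * gibbsDensity Φ x := by
  obtain ⟨n, B, D, N, hn, hB, hD, hN, hsq, hyoung⟩ := h.exists_young_modifiedH
  obtain ⟨K, hK, hpoinc⟩ := h.exists_poincare
  obtain ⟨C, hC, hderiv⟩ := h.abs_deriv_le
  set p := gibbsDensity Φ with hp
  have hpc : Continuous p := h.continuous_gibbsDensity
  have hppos : ∀ x, 0 < p x := h.gibbsDensity_pos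
  have hp0 : ∀ x, 0 ≤ p x := fun x => (hppos x).le
  have hpi : Integrable p := h.integrable_gibbsDensity
  set Ψ₁ := Φ 1 - Φ 0 with hΨ₁
  have hΨ₁0 : 0 ≤ Ψ₁ := sub_nonneg.2 (h.apply_zero_le 1)
  -- `C₄ J` bounds `u p`: `Ψ₁ / 2 + 1` comes from `u' p`, `C` from `u p'`, and `4` from the moment,
  -- which is at most `4 J`.
  set C₄ := Ψ₁ / 2 + 5 + C with hC₄
  set Z := ∫ y, exp (-Φ y) with hZ
  have hC₄0 : 0 < C₄ := by positivity
  refine ⟨(21 + |Φ 0| + |log Z| + C₄) * (16 * N * K + 1), B, D, by positivity, hB, hD,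
    fun f hf hfpos hfi hf1 hHi => ?_⟩
  set H : ℝ → ℝ := fun x => modifiedH Φ B D (deriv f x / f x) with hH
  have hH0 : ∀ x, 0 ≤ H x := fun x => (sq_nonneg _).trans (hsq _)
  have hfc := hf.continuous
  set I := ∫ x, H x * f x ^ 2 * p x with hI
  have hdle : ∀ x, deriv f x ^ 2 * p x ≤ H x * f x ^ 2 * p x := fun x => by
    have h1 := mul_le_mul_of_nonneg_right (hsq (deriv f x / f x)) (sq_nonneg (f x))
    rw [div_pow, div_mul_cancel₀ _ (pow_pos (hfpos x) 2).ne'] at h1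
    exact mul_le_mul_of_nonneg_right h1 (hp0 x)
  have hdi : Integrable fun x => deriv f x ^ 2 * p x := by
    refine hHi.mono' ?_ (Filter.Eventually.of_forall fun x => ?_)
    · exact (((measurable_deriv f).pow_const 2).mul hpc.measurable).aestronglyMeasurable
    · rw [norm_of_nonneg (mul_nonneg (sq_nonneg _) (hp0 x))]
      exact hdle x
  obtain ⟨hsqi, hone⟩ := integral_sub_one_sq_mul_le hfc hpc hp0 hpi h.integral_gibbsDensity
    (hfpos 0) hfi hf1
  have hvar : ∫ x, (f x - 1) ^ 2 * p x ≤ 4 * K * I := by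
    have h1 := hpoinc f hf (hsqi _) hdi
    have h2 := mul_le_mul_of_nonneg_left (integral_mono hdi hHi hdle) hK.le
    linarith
  -- One error term for all estimates: where `f ≥ 2`, `N f² ≤ 4 N (f - 1)²`, which converts the
  -- additive constant of Young's inequality into a variance.
  set q : ℝ → ℝ := fun x => 4 * N * (f x - 1) ^ 2 + H x * f x ^ 2 with hq
  have hq0 : ∀ x, 0 ≤ q x := fun x => by have := hH0 x; simp only [hq]; positivity
  have hqp : (fun x => q x * p x) =
      fun x => 4 * N * ((f x - 1) ^ 2 * p x) + H x * f x ^ 2 * p x := by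
    ext x; simp only [hq]; ring
  have hqi : Integrable fun x => q x * p x := by
    rw [hqp]; exact ((hsqi 1).const_mul _).add hHi
  set J := ∫ x, q x * p x with hJ
  have hJ0 : 0 ≤ J := integral_nonneg fun x => mul_nonneg (hq0 x) (hp0 x)
  have hJI : J ≤ (16 * N * K + 1) * I := by
    rw [hJ, hqp, integral_add ((hsqi 1).const_mul _) hHi, integral_const_mul]
    nlinarith
  set u := cutoffSq n f with hu
  have huac : LocallyAbsolutelyContinuous u := hf.cutoffSq n
  have huc := huac.continuous
  have hu0 : ∀ x, 0 ≤ u x := cutoffSq_nonneg n f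
  have hsub : ∀ x, (f x - 1) ^ 2 ≤ q x := fun x => by
    have := mul_nonneg (hH0 x) (sq_nonneg (f x))
    simp only [hq]
    nlinarith [sq_nonneg (f x - 1)]
  have huq : ∀ x, u x ≤ q x := fun x => by
    have h1 := cutoffSq_le n f x
    have := mul_nonneg (hH0 x) (sq_nonneg (f x))
    simp only [hq]
    nlinarith [sq_nonneg (f x - 1)]
  have hui : Integrable fun x => u x * p x := by
    refine hfi.mono' (by fun_prop) (Filter.Eventually.of_forall fun x => ?_)
    rw [norm_of_nonneg (mul_nonneg (hu0 x) (hp0 x))]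
    exact mul_le_mul_of_nonneg_right (cutoffSq_le_sq n f x) (hp0 x)
  have huJ : ∫ x, u x * p x ≤ J :=
    integral_mono hui hqi fun x => mul_le_mul_of_nonneg_right (huq x) (hp0 x)
  have hu1 : ∫ x, u x * p x ≤ 1 := by
    rw [← hf1]
    exact integral_mono hui hfi fun x =>
      mul_le_mul_of_nonneg_right (cutoffSq_le_sq n f x) (hp0 x)
  have hudiff := huac.ae_differentiableAt
  have hσdiff := LocallyAbsolutelyContinuous.ae_differentiableAt (f := fun y => unitClamp (f y))
    fun a b => lipschitzWith_unitClamp.comp_absolutelyContinuousOnInterval (hf a b)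
  -- The free `z` is used twice: `z = x` for the moment, `z = 1` for `|u'|` itself.
  have hu' : ∀ᵐ x, ∀ z, |z| * |deriv u x| ≤ u x * (Φ z - Φ 0) / 2 + q x := by
    filter_upwards [hf.ae_differentiableAt, hσdiff] with x hx hσx z
    have h1 := abs_deriv_cutoffSq_le (n := n) (hfpos x) hx hσx
    rcases le_total (f x) 2 with h2 | h2
    · rw [unitClamp_of_le h2, zero_pow (by omega), mul_zero, zero_mul, mul_zero] at h1
      rw [hu, cutoffSq_of_le h2, le_antisymm h1 (abs_nonneg _)]
      simpa using hq0 x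
    · have h3 := mul_le_mul_of_nonneg_left h1 (abs_nonneg z)
      have h4 := mul_le_mul_of_nonneg_left (hyoung (unitClamp (f x)) z (deriv f x / f x)
        (unitClamp_nonneg _) (unitClamp_le_one _)) (sq_nonneg (f x))
      have h5 : f x ^ 2 * N ≤ 4 * N * (f x - 1) ^ 2 := by
        have : f x ^ 2 ≤ 4 * (f x - 1) ^ 2 := by nlinarith
        nlinarith
      calc |z| * |deriv u x| ≤ _ := h3
        _ = f x ^ 2 * ((3 * n + 5) * (unitClamp (f x) ^ n * |z| * |deriv f x / f x|)) := by ring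
        _ ≤ _ := h4
        _ ≤ u x * (Φ z - Φ 0) / 2 + q x := by
          simp only [hu, cutoffSq, hq, hH]
          linarith
  obtain ⟨hmi, hm⟩ := h.integral_mul_deriv_mul_le huac hu0 hq0 hui hqi (by
    filter_upwards [hu'] with x hx
    refine le_trans ?_ (hx x)
    rw [← abs_mul]
    exact le_abs_self _)
  rw [← hp] at hmi hm
  have hvac : LocallyAbsolutelyContinuous fun x => u x * p x :=
    huac.mul h.contDiff_gibbsDensity.locallyAbsolutelyContinuous
  have hv' : ∀ᵐ x, ‖deriv (fun x => u x * p x) x‖ ≤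
      (Ψ₁ / 2 + 1 + C) * (q x * p x) + x * deriv Φ x * u x * p x := by
    filter_upwards [hu', hudiff] with x hx hdx
    have e := (hdx.hasDerivAt.fun_mul (h.hasDerivAt_gibbsDensity x)).deriv
    rw [e, norm_eq_abs]
    refine (abs_add_le _ _).trans ?_
    rw [abs_mul, abs_mul, abs_neg, abs_mul, abs_of_pos (h.gibbsDensity_pos x),
      abs_of_nonneg (hu0 x)]
    have h1 := hx 1
    rw [abs_one, one_mul] at h1
    have h2 : |deriv u x| ≤ (Ψ₁ / 2 + 1) * q x := by
      have := mul_le_mul_of_nonneg_right (huq x) hΨ₁0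
      linarith
    have h3 : u x * |deriv Φ x| ≤ x * deriv Φ x * u x + C * q x := by
      have h4 := mul_le_mul_of_nonneg_left (hderiv x) (hu0 x)
      have h5 := mul_le_mul_of_nonneg_left (huq x) hC
      linarith
    have h6 := mul_le_mul_of_nonneg_right h2 (hp0 x)
    have h7 := mul_le_mul_of_nonneg_right h3 (hp0 x)
    linarith
  have hvbi := (hqi.const_mul (Ψ₁ / 2 + 1 + C)).add hmi
  have hvi : Integrable (deriv fun x => u x * p x) :=
    hvbi.mono' (measurable_deriv _).aestronglyMeasurable hv'
  have hV : ∀ x, u x * p x ≤ C₄ * J := fun x => by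
    refine (hvac.le_integral_abs_deriv hui hvi x).trans ?_
    have h1 := integral_mono_ae hvi.norm hvbi hv'
    simp only [norm_eq_abs, Pi.add_apply] at h1
    rw [integral_add (hqi.const_mul _) hmi, integral_const_mul] at h1
    rw [hC₄]
    linarith
  set G : ℝ → ℝ := fun x => (17 + |Φ 0| + |log Z|) * (q x * p x) + C₄ * J * (u x * p x) +
    x * deriv Φ x * u x * p x with hG
  have hG1 := (hqi.const_mul (17 + |Φ 0| + |log Z|)).add (hui.const_mul (C₄ * J))
  have hGi : Integrable G := hG1.add hmi
  have hle : ∀ x, (f x ^ 2 * log (f x ^ 2) - f x ^ 2 + 1) * p x ≤ G x := fun x => by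
    have h1 := sq_mul_log_sq_le (hfpos x) cutoffSq_of_le (hu0 x) cutoffSq_of_ge (hppos x) (hV x)
    rw [hp, h.log_gibbsDensity] at h1
    have h2 : C₄ * J - (-Φ x - log Z) ≤ C₄ * J + x * deriv Φ x + (|Φ 0| + |log Z|) := by
      linarith [h.sub_le_mul_deriv x, le_abs_self (Φ 0), le_abs_self (log Z)]
    have h3 := mul_le_mul_of_nonneg_left h2 (hu0 x)
    have h4 := mul_le_mul_of_nonneg_right (huq x)
      (add_nonneg (abs_nonneg (Φ 0)) (abs_nonneg (log Z)))
    have h5 : f x ^ 2 * log (f x ^ 2) - f x ^ 2 + 1 ≤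
        (17 + |Φ 0| + |log Z|) * q x + C₄ * J * u x + x * deriv Φ x * u x := by
      linarith [hsub x]
    refine (mul_le_mul_of_nonneg_right h5 (hp0 x)).trans_eq ?_
    simp only [hG]
    ring
  have hFi : Integrable fun x => (f x ^ 2 * log (f x ^ 2) - f x ^ 2 + 1) * p x := by
    refine hGi.mono' ?_ (Filter.Eventually.of_forall fun x => ?_)
    · have : Measurable f := hfc.measurable
      have := hpc.measurable
      exact Measurable.aestronglyMeasurable (by fun_prop)
    · rw [norm_of_nonneg (mul_nonneg (sq_mul_log_sq_nonneg (hfpos x)) (hp0 x))]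
      exact hle x
  refine ⟨hFi, (integral_mono hFi hGi hle).trans ?_⟩
  have hGval : ∫ x, G x = (17 + |Φ 0| + |log Z|) * J + C₄ * J * (∫ x, u x * p x) +
      ∫ x, x * deriv Φ x * u x * p x := by
    rw [hG]
    refine (integral_add hG1 hmi).trans ?_
    congr 1
    refine (integral_add (hqi.const_mul _) (hui.const_mul _)).trans ?_
    rw [integral_const_mul, integral_const_mul]
  rw [hGval]
  -- The term `C₄ J ∫ u p` would be quadratic in `J`; the normalization, through `∫ u p ≤ 1`, makes
  -- it linear.
  have h1 := mul_le_mul_of_nonneg_left hu1 (mul_nonneg hC₄0.le hJ0)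
  have h2 := mul_le_mul_of_nonneg_left hJI
    (show 0 ≤ 21 + |Φ 0| + |log Z| + C₄ by positivity)
  linarith

end HypothesisH

theorem mainTheorem2 (Φ : ℝ → ℝ) (hΦ : HypothesisH Φ) :
    ∃ A B D : ℝ, 0 < A ∧ 0 < B ∧ 0 < D ∧
      ∀ f : ℝ → ℝ, LocallyAbsolutelyContinuous f → (∀ x, 0 < f x) →
        Integrable (fun x => f x ^ 2) (gibbsMeasure Φ) →
        Integrable (fun x => modifiedH Φ B D (deriv f x / f x) * f x ^ 2) (gibbsMeasure Φ) →
          Integrable (fun x => f x ^ 2 * log (f x ^ 2)) (gibbsMeasure Φ) ∧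
          entropy (gibbsMeasure Φ) (fun x => f x ^ 2) ≤
            A * ∫ x, modifiedH Φ B D (deriv f x / f x) * f x ^ 2 ∂(gibbsMeasure Φ) := by
  obtain ⟨A, B, D, hA, hB, hD, key⟩ := hΦ.exists_entropy_bound_of_normalized
  refine ⟨A, B, D, hA, hB, hD, fun f hf hfpos hfi hHi => ?_⟩
  have := hΦ.isProbabilityMeasure
  set μ := gibbsMeasure Φ with hμ
  set m := ∫ x, f x ^ 2 ∂μ with hm
  have hm0 : 0 < m := by
    rw [hm, integral_pos_iff_support_of_nonneg (fun x => sq_nonneg (f x)) hfi]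
    have : Function.support (fun x => f x ^ 2) = univ :=
      eq_univ_of_forall fun x => (pow_pos (hfpos x) 2).ne'
    rw [this, measure_univ]
    exact one_pos
  set c := (√m)⁻¹ with hc
  have hc0 : 0 < c := inv_pos.2 (sqrt_pos.2 hm0)
  have hc2 : c ^ 2 = m⁻¹ := by rw [hc, inv_pow, sq_sqrt hm0.le]
  have hgsq : ∀ x, (c * f x) ^ 2 = m⁻¹ * f x ^ 2 := fun x => by rw [mul_pow, hc2]
  have hratio : ∀ x, deriv (fun y => c * f y) x / (c * f x) = deriv f x / f x := fun x => by
    rw [deriv_const_mul_field, mul_div_mul_left _ _ hc0.ne']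
  have hgi : Integrable (fun x => (c * f x) ^ 2) μ := by
    simp only [hgsq]; exact hfi.const_mul _
  have hg1 : ∫ x, (c * f x) ^ 2 ∂μ = 1 := by
    simp only [hgsq]
    rw [integral_const_mul, ← hm, inv_mul_cancel₀ hm0.ne']
  have hgH : (fun x => modifiedH Φ B D (deriv (fun y => c * f y) x / (c * f x)) * (c * f x) ^ 2) =
      fun x => m⁻¹ * (modifiedH Φ B D (deriv f x / f x) * f x ^ 2) := by
    ext x
    rw [hratio, hgsq]
    ring
  have hgHi : Integrable (fun x =>
      modifiedH Φ B D (deriv (fun y => c * f y) x / (c * f x)) * (c * f x) ^ 2) μ := by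
    rw [hgH]; exact hHi.const_mul _
  obtain ⟨h1, h2⟩ := key (fun x => c * f x) (hf.const_mul c) (fun x => mul_pos hc0 (hfpos x))
    (hΦ.integrable_gibbsMeasure_iff.1 hgi) (by rw [← hΦ.integral_gibbsMeasure, hg1])
    (hΦ.integrable_gibbsMeasure_iff.1 hgHi)
  rw [← hΦ.integral_gibbsMeasure, ← hΦ.integral_gibbsMeasure, hgH, integral_const_mul] at h2
  replace h1 := hΦ.integrable_gibbsMeasure_iff.2 h1
  -- Once integrated, the last two terms give `m log m`, so the entropy of `f²` is `m` times the
  -- normalized one.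
  have hpt : (fun x => f x ^ 2 * log (f x ^ 2)) = fun x =>
      m * ((c * f x) ^ 2 * log ((c * f x) ^ 2) - (c * f x) ^ 2 + 1) +
        (1 + log m) * f x ^ 2 - m := by
    ext x
    rw [hgsq, log_mul (inv_pos.2 hm0).ne' (pow_pos (hfpos x) 2).ne', log_inv]
    field_simp
    ring
  have hsum := (h1.const_mul m).add (hfi.const_mul (1 + log m))
  have hlog : Integrable (fun x => f x ^ 2 * log (f x ^ 2)) μ := by
    rw [hpt]
    exact hsum.sub (integrable_const m)
  refine ⟨hlog, ?_⟩
  have hval : ∫ x, f x ^ 2 * log (f x ^ 2) ∂μ =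
      m * (∫ x, ((c * f x) ^ 2 * log ((c * f x) ^ 2) - (c * f x) ^ 2 + 1) ∂μ) +
        (1 + log m) * m - m := by
    rw [hpt]
    refine (integral_sub hsum (integrable_const m)).trans ?_
    rw [integral_const, probReal_univ, one_smul]
    congr 1
    refine (integral_add (h1.const_mul m) (hfi.const_mul _)).trans ?_
    rw [integral_const_mul, integral_const_mul]
  have h3 := mul_le_mul_of_nonneg_left h2 hm0.le
  have e : m * (A * (m⁻¹ * ∫ x, modifiedH Φ B D (deriv f x / f x) * f x ^ 2 ∂μ)) =
      A * ∫ x, modifiedH Φ B D (deriv f x / f x) * f x ^ 2 ∂μ := by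
    field_simp
  rw [e] at h3
  rw [entropy, hval, ← hm]
  linarith
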